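/- Let $(M,S)$ be a tangent manifold of dimension $2n$: $M$ is a smooth (Hausdorff, second countable) manifold and $S$ is a field of endomorphisms of $TM$ with $\operatorname{im} S=\ker S$ such that around every point there are local coordinates $(x^i,y^i)_{i=1}^n$ with $S(\partial/\partial x^i)=\partial/\partial y^i$, $S(\partial/\partial y^i)=0$. Let $\mathcal V$ be the vertical foliation, $T\mathcal V=\operatorname{im}S$ (its leaves are locally $x^i=\mathrm{const}$). Fix a smooth distribution $N\mathcal V$ with $TM=N\mathcal V\oplus T\mathcal V$, with projections $p_N,p_T$, and a non degenerate (possibly indefinite) metric $g$ on the transversal bundle $TM/T\mathcal V$. Let $\gamma$ be its canonical extension, i.e. the pseudo-Riemannian metric on $M$ for which $N\mathcal V\perp T\mathcal V$, $\gamma|_{N\mathcal V}=g$ and $\gamma(SX,SY)=\gamma(X,Y)$ for $X,Y\in\Gamma N\mathcal V$, and let $\nabla$ be the Levi-Civita connection of $\gamma$. The canonical connection $D$ is defined, for $Z_1,Z_2\in\Gamma N\mathcal V$ and $Y_1,Y_2\in\Gamma T\mathcal V$, by $$D_{Z_1}Z_2=p_N\nabla_{Z_1}Z_2,\quad D_{Y_1}Y_2=p_T\nabla_{Y_1}Y_2,\quad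 D_{Y_1}Z_2=p_N[Y_1,Z_2],\quad D_{Z_1}Y_2=p_T[Z_1,Y_2],$$ and additivity; its curvature is $R_D(X,Y)Z=D_XD_YZ-D_YD_XZ-D_{[X,Y]}Z$. A vector field is foliated on an open set if, near each point of that set, it has the form $\sum_i\xi^i(x)\,\partial/\partial x^i+\sum_i\eta^i(x,y)\,\partial/\partial y^i$ in some coordinates as above. Then, for all $X,Y,Z\in\Gamma N\mathcal V$ that are foliated on an open set $U\subseteq M$ (for instance $U=M$), the following hold on $U$: $$\begin{aligned} &(1)\quad R_D(SX,SY)Z=0,\\ &(2)\quad R_D(SX,Y)Z=p_N[SX,D_YZ],\\ &(3)\quad R_D(X,Y)(SZ)=-D_{SZ}(p_T[X,Y]),\\ &(4)\quad R_D(SX,Y)Z=R_D(SX,Z)Y. \end{aligned}$$ Moreover, (1) and (4) hold on $M$ for arbitrary $X,Y,Z\in\Gamma N\mathcal V$, and so does (3) in the tensorial form $$(3')\quad R_D(X,Y)(SZ)=-(D_{SZ}\Theta)(X,Y),\qquad \Theta(X,Y)=p_T[p_NX,p_NY],$$ where $(D_W\Theta)(X,Y)=D_W(\Theta(X,Y))-\Theta(D_WX,Y)-\Theta(X,D_WY)$.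 -/

import Mathlib

open scoped Manifold ContDiff Topology

/-- The coordinate space `ℝⁿ × ℝⁿ` on which a tangent manifold of dimension `2n` is modelled;
its points are written `(x, y) = (xⁱ, yⁱ)`. -/
abbrev XYSpace (n : ℕ) : Type := EuclideanSpace ℝ (Fin n) × EuclideanSpace ℝ (Fin n)

namespace TangentManifold

noncomputable section

section Basic

variable (n : ℕ) (M : Type*) [TopologicalSpace M] [ChartedSpace (XYSpace n) M]

/-- The tangent space `T_x M`. -/
abbrev T (x : M) : Type := TangentSpace 𝓘(ℝ, XYSpace n) x

/-- (Not necessarily smooth) vector fields on `M`. -/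
abbrev Field : Type _ := (x : M) → T n M x

end Basic

variable {n : ℕ} {M : Type*} [TopologicalSpace M] [ChartedSpace (XYSpace n) M]

/-- The vector field `X` is of class `C^∞`. -/
def IsSmooth [IsManifold 𝓘(ℝ, XYSpace n) ∞ M] (X : Field n M) : Prop :=
  ContMDiff 𝓘(ℝ, XYSpace n) 𝓘(ℝ, XYSpace n).tangent ∞
    (fun x ↦ (⟨x, X x⟩ : TangentBundle 𝓘(ℝ, XYSpace n) M))

/-- The Lie bracket of vector fields. -/
abbrev bracket (X Y : Field n M) : Field n M :=
  VectorField.mlieBracket 𝓘(ℝ, XYSpace n) X Y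

/-- The components of the tangent vector `v` at `z` in the local coordinates `(xⁱ, yⁱ)` given by
the chart `φ`: the vector `∑ aⁱ ∂/∂xⁱ + ∑ bⁱ ∂/∂yⁱ` has components `(a, b)`. -/
def components (φ : OpenPartialHomeomorph M (XYSpace n)) (z : M) (v : T n M z) : XYSpace n :=
  mfderiv 𝓘(ℝ, XYSpace n) 𝓘(ℝ, XYSpace n) φ z v

/-- The local coordinates `(xⁱ, yⁱ)` given by the chart `φ` are adapted to the field of
endomorphisms `S`, that is `S (∂/∂xⁱ) = ∂/∂yⁱ` and `S (∂/∂yⁱ) = 0`. -/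
def IsAdaptedChart (S : (x : M) → T n M x →L[ℝ] T n M x)
    (φ : OpenPartialHomeomorph M (XYSpace n)) : Prop :=
  φ ∈ IsManifold.maximalAtlas 𝓘(ℝ, XYSpace n) ∞ M ∧
    ∀ z ∈ φ.source, ∀ v : T n M z,
      components φ z (S z v) = (0, (components φ z v).1)

variable (n M) in
/-- A tangent structure on `M`: a field `S` of endomorphisms of `TM` with `im S = ker S`
(in particular `S² = 0`) which is integrable, i.e. around every point there are local coordinates
with `S (∂/∂xⁱ) = ∂/∂yⁱ`, `S (∂/∂yⁱ) = 0` (in particular `S` is smooth). -/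
structure TangentStructure where
  S : (x : M) → T n M x →L[ℝ] T n M x
  range_eq_ker : ∀ x, (S x : T n M x →ₗ[ℝ] T n M x).range = (S x : T n M x →ₗ[ℝ] T n M x).ker
  integrable : ∀ x, ∃ φ : OpenPartialHomeomorph M (XYSpace n), x ∈ φ.source ∧ IsAdaptedChart S φ

namespace TangentStructure

variable (τ : TangentStructure n M)

/-- The tangent bundle `T𝓥 = im S` of the vertical foliation. -/
def vert (x : M) : Submodule ℝ (T n M x) := (τ.S x : T n M x →ₗ[ℝ] T n M x).range

/-- The vector field `SX`. -/
def app (X : Field n M) : Field n M := fun x ↦ τ.S x (X x)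

/-- The vector field `X` is foliated (projectable) on the open set `U`: locally in `U`, there are
adapted coordinates `(xⁱ, yⁱ)`, so that the leaves are `xⁱ = const`, with
`X = ∑ ξⁱ(x) ∂/∂xⁱ + ∑ ηⁱ(x, y) ∂/∂yⁱ`, i.e. `X` projects to a vector field `ξ` on the
local space of leaves. -/
def IsFoliatedOn (U : Set M) (X : Field n M) : Prop :=
  ∀ z ∈ U, ∃ φ : OpenPartialHomeomorph M (XYSpace n),
    z ∈ φ.source ∧ φ.source ⊆ U ∧ IsAdaptedChart τ.S φ ∧
    ∃ ξ : EuclideanSpace ℝ (Fin n) → EuclideanSpace ℝ (Fin n),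
      ∀ w ∈ φ.source, (components φ w (X w)).1 = ξ (φ w).1

end TangentStructure

/-- A normalization of the vertical foliation of a tangent manifold: a smooth distribution
`N = N𝓥` with `TM = N𝓥 ⊕ T𝓥`. Smoothness of `N` is expressed by smoothness of the
corresponding field of projections `p_N`. -/
structure Normalization [IsManifold 𝓘(ℝ, XYSpace n) ∞ M] (τ : TangentStructure n M) where
  N : (x : M) → Submodule ℝ (T n M x)
  isCompl : ∀ x, IsCompl (N x) (τ.vert x)
  smooth : ∀ X : Field n M, IsSmooth X →
    IsSmooth (fun x ↦ (N x).projection (τ.vert x) (isCompl x) (X x))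

/-- A (possibly indefinite) metric of the transversal bundle `TM / T𝓥`, seen as a smooth symmetric
2-covariant tensor field on `M` whose kernel at every point is exactly `T𝓥 = im S`:
it is annihilated by `im S` and non degenerate on `TM / T𝓥`. -/
structure TransversalMetric [IsManifold 𝓘(ℝ, XYSpace n) ∞ M] (τ : TangentStructure n M) where
  g : (x : M) → T n M x →ₗ[ℝ] T n M x →ₗ[ℝ] ℝ
  symm : ∀ x v w, g x v w = g x w v
  ker_eq : ∀ x v, (∀ w, g x v w = 0) ↔ v ∈ τ.vert x
  smooth : ∀ X Y : Field n M, IsSmooth X → IsSmooth Y →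
    ContMDiff 𝓘(ℝ, XYSpace n) 𝓘(ℝ, ℝ) ∞ (fun x ↦ g x (X x) (Y x))

variable [IsManifold 𝓘(ℝ, XYSpace n) ∞ M] {τ : TangentStructure n M}

namespace Normalization

variable (ν : Normalization τ)

/-- The projection `p_N : TM → N𝓥` along `T𝓥`. -/
def pN (x : M) : T n M x →ₗ[ℝ] T n M x :=
  (ν.N x).projection (τ.vert x) (ν.isCompl x)

/-- The projection `p_T : TM → T𝓥` along `N𝓥`. -/
def pT (x : M) : T n M x →ₗ[ℝ] T n M x :=
  (τ.vert x).projection (ν.N x) (ν.isCompl x).symm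

/-- The vector field `p_N X`. -/
def normal (X : Field n M) : Field n M := fun x ↦ ν.pN x (X x)

/-- The vector field `p_T X`. -/
def tangential (X : Field n M) : Field n M := fun x ↦ ν.pT x (X x)

/-- `X ∈ Γ N𝓥`, that is, `X` is a smooth horizontal vector field. -/
def IsHorizontal (X : Field n M) : Prop := IsSmooth X ∧ ∀ x, X x ∈ ν.N x

/-- `S` restricted to a map `N𝓥 → T𝓥`. -/
def restrictS (x : M) : ν.N x →ₗ[ℝ] τ.vert x :=
  (τ.S x : T n M x →ₗ[ℝ] T n M x).rangeRestrict ∘ₗ (ν.N x).subtype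

theorem restrictS_bijective (x : M) : Function.Bijective (ν.restrictS x) := by
  have hd := ν.isCompl x
  constructor
  · rw [← LinearMap.ker_eq_bot, LinearMap.ker_eq_bot']
    intro v hv
    have h0 : τ.S x (v : T n M x) = 0 := congrArg Subtype.val hv
    have h1 : (v : T n M x) ∈ τ.vert x := by
      rw [TangentStructure.vert, τ.range_eq_ker x]
      exact h0
    exact Subtype.ext ((Submodule.disjoint_def.1 hd.disjoint) _ v.2 h1)
  · rintro ⟨_, u, rfl⟩
    refine ⟨⟨ν.pN x u, Submodule.projection_apply_mem _ _⟩, Subtype.ext ?_⟩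
    have h2 : u - ν.pN x u ∈ τ.vert x := by
      rw [← Submodule.projection_apply_eq_zero_iff hd, map_sub, pN,
        Submodule.projection_apply_of_mem_left hd (Submodule.projection_apply_mem hd u), sub_self]
    rw [TangentStructure.vert, τ.range_eq_ker x, LinearMap.mem_ker, map_sub, sub_eq_zero] at h2
    exact h2.symm

/-- The isomorphism `Q = S|_{N𝓥} : N𝓥 → T𝓥`. -/
def Q (x : M) : ν.N x ≃ₗ[ℝ] τ.vert x :=
  LinearEquiv.ofBijective (ν.restrictS x) (ν.restrictS_bijective x)

/-- `S' = 0 ⊕ Q⁻¹`, which vanishes on `N𝓥` and is `Q⁻¹` on `T𝓥`. -/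
def S' (x : M) : T n M x →ₗ[ℝ] T n M x :=
  (ν.N x).subtype ∘ₗ (ν.Q x).symm.toLinearMap ∘ₗ
    (τ.vert x).projectionOnto (ν.N x) (ν.isCompl x).symm

/-- The canonical extension `γ` of the transversal metric `g`: the pseudo-Riemannian metric on `M`
for which `N𝓥` and `T𝓥` are orthogonal, `γ = g` on `N𝓥`, and `γ(SX, SY) = γ(X, Y)` for
`X, Y` in `N𝓥`. -/
def canonicalExtension (g : TransversalMetric τ) (x : M) (v w : T n M x) : ℝ :=
  g.g x (ν.pN x v) (ν.pN x w) + g.g x (ν.S' x v) (ν.S' x w)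

end Normalization

/-- `∇` is the Levi-Civita connection of the pseudo-Riemannian metric `γ`: it is smooth, it
has no torsion, and `X(γ(Y, Z)) = γ(∇_X Y, Z) + γ(Y, ∇_X Z)`.
Here `∇ Y x v` is the covariant derivative of `Y` in the direction of `v ∈ T_x M`. -/
structure IsLeviCivita (γ : (x : M) → T n M x → T n M x → ℝ)
    (nabla : CovariantDerivative 𝓘(ℝ, XYSpace n) (XYSpace n) (T n M)) : Prop where
  smooth : ∀ X Y : Field n M, IsSmooth X → IsSmooth Y → IsSmooth (fun x ↦ nabla Y x (X x))
  torsion_free : ∀ X Y : Field n M, IsSmooth X → IsSmooth Y →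
    ∀ x, nabla Y x (X x) - nabla X x (Y x) = bracket X Y x
  metric : ∀ Y Z : Field n M, IsSmooth Y → IsSmooth Z → ∀ (x : M) (v : T n M x),
    (mfderiv 𝓘(ℝ, XYSpace n) 𝓘(ℝ, ℝ) (fun z ↦ γ z (Y z) (Z z)) x v : ℝ) =
      γ x (nabla Y x v) (Z x) + γ x (Y x) (nabla Z x v)

/-- The canonical connection `D_X Y`, built from the Levi-Civita connection `∇` of the canonical
extension of `g`. For `Z₁, Z₂ ∈ Γ N𝓥` and `Y₁, Y₂ ∈ Γ T𝓥`,
`D_{Z₁} Z₂ = p_N ∇_{Z₁} Z₂`, `D_{Y₁} Y₂ = p_T ∇_{Y₁} Y₂`, `D_{Y₁} Z₂ = p_N [Y₁, Z₂]`,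
`D_{Z₁} Y₂ = p_T [Z₁, Y₂]`, extended by additivity through `X = p_N X + p_T X`. -/
def canonicalD (ν : Normalization τ)
    (nabla : CovariantDerivative 𝓘(ℝ, XYSpace n) (XYSpace n) (T n M)) (X Y : Field n M) :
    Field n M := fun x ↦
  ν.pN x (nabla (ν.normal Y) x (ν.normal X x)) +
  ν.pT x (nabla (ν.tangential Y) x (ν.tangential X x)) +
  ν.pN x (bracket (ν.tangential X) (ν.normal Y) x) +
  ν.pT x (bracket (ν.normal X) (ν.tangential Y) x)

/-- The curvature `R(X, Y) Z = D_X D_Y Z - D_Y D_X Z - D_{[X, Y]} Z`. -/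
def curvature (D : Field n M → Field n M → Field n M) (X Y Z : Field n M) : Field n M :=
  D X (D Y Z) - D Y (D X Z) - D (bracket X Y) Z

/-- The curvature `R_D` of the canonical connection `D`. -/
def canonicalR (ν : Normalization τ)
    (nabla : CovariantDerivative 𝓘(ℝ, XYSpace n) (XYSpace n) (T n M)) (X Y Z : Field n M) :
    Field n M :=
  curvature (canonicalD ν nabla) X Y Z

/-- The tensor field `Θ(X, Y) = p_T [p_N X, p_N Y]` on `M`. -/
def Normalization.theta (ν : Normalization τ) (X Y : Field n M) : Field n M :=
  ν.tangential (bracket (ν.normal X) (ν.normal Y))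

/-- The covariant derivative `(D_W A)(X, Y) = D_W (A(X, Y)) - A(D_W X, Y) - A(X, D_W Y)` of a
vector valued 2-covariant tensor field `A`. -/
def covDerivTensor (D : Field n M → Field n M → Field n M)
    (A : Field n M → Field n M → Field n M) (W X Y : Field n M) : Field n M :=
  D W (A X Y) - A (D W X) Y - A X (D W Y)

end

end TangentManifold

/-! Three facts carry the proof: the Jacobi identity, vanishing torsion of `nabla`, and two
properties of the vertical foliation: it is involutive, and the bracket of a vertical field with a
foliated one is vertical (`bracket_mem_vert_of_foliated`). `S` only serves to produce vertical
fields, so `SX` is replaced throughout by an arbitrary vertical `V`.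

On horizontal fields `D_V Z = p_N[V, Z]` is the Bott connection. Involutivity gives `p_N[V, p_N A] =
p_N[V, A]`, so its flatness (1) is the normal part of Jacobi. For (4) and (3'), the curvature is
expanded, torsion-freeness turns differences of covariant derivatives into brackets, and what
remains is the `p_N` or `p_T` part of Jacobi, each bracket being split into its two components.

For foliated arguments `p_N[V, Z]` vanishes on the whole open set `U`. All operators involved are
local, so the correction terms drop out: this gives (2), and reduces (3') to (3). -/

namespace TangentManifold

open VectorField

/-! ### Vector fields and brackets read in charts -/

section Charts

variable {n : ℕ} {M : Type*} [TopologicalSpace M] [ChartedSpace (XYSpace n) M]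
  {φ : OpenPartialHomeomorph M (XYSpace n)}

theorem two_le_smoothness : (2 : ℕ∞ω) ≤ ∞ := by
  have h : ((2 : ℕ∞) : ℕ∞ω) ≤ ∞ := WithTop.coe_le_coe.2 le_top
  exact h

/-- The components of the vector field `X` in the chart `φ`, as functions of the coordinates. -/
noncomputable def chartField (φ : OpenPartialHomeomorph M (XYSpace n)) (X : Field n M) :
    XYSpace n → XYSpace n :=
  fun p ↦ components φ (φ.symm p) (X (φ.symm p))

theorem mdifferentiable_of_mem_maximalAtlas
    (hφ : φ ∈ IsManifold.maximalAtlas 𝓘(ℝ, XYSpace n) ∞ M) :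
    φ.MDifferentiable 𝓘(ℝ, XYSpace n) 𝓘(ℝ, XYSpace n) :=
  ⟨(contMDiffOn_of_mem_maximalAtlas hφ).mdifferentiableOn (by simp),
    (contMDiffOn_symm_of_mem_maximalAtlas hφ).mdifferentiableOn (by simp)⟩

theorem chartField_apply (X : Field n M) {z : M} (hz : z ∈ φ.source) :
    chartField φ X (φ z) = components φ z (X z) := by
  rw [chartField, φ.left_inv hz]

theorem isInvertible_mfderiv_chart (hφ : φ ∈ IsManifold.maximalAtlas 𝓘(ℝ, XYSpace n) ∞ M)
    {z : M} (hz : z ∈ φ.source) :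
    (mfderiv 𝓘(ℝ, XYSpace n) 𝓘(ℝ, XYSpace n) φ z).IsInvertible :=
  ⟨(mdifferentiable_of_mem_maximalAtlas hφ).mfderiv hz, rfl⟩

theorem isInvertible_mfderiv_chart_symm
    (hφ : φ ∈ IsManifold.maximalAtlas 𝓘(ℝ, XYSpace n) ∞ M) {p : XYSpace n} (hp : p ∈ φ.target) :
    (mfderiv 𝓘(ℝ, XYSpace n) 𝓘(ℝ, XYSpace n) φ.symm p).IsInvertible :=
  ⟨(mdifferentiable_of_mem_maximalAtlas hφ).symm.mfderiv hp, rfl⟩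

/-- The pullback along `φ.symm` applies the inverse of its derivative, which is the derivative of
`φ`. Smoothness and naturality of the bracket under pullback thus carry over to coordinate
expressions. -/
theorem mpullback_chart_symm (hφ : φ ∈ IsManifold.maximalAtlas 𝓘(ℝ, XYSpace n) ∞ M)
    (X : Field n M) {p : XYSpace n} (hp : p ∈ φ.target) :
    mpullback 𝓘(ℝ, XYSpace n) 𝓘(ℝ, XYSpace n) φ.symm X p = chartField φ X p := by
  have hd := mdifferentiable_of_mem_maximalAtlas hφ
  have h := hd.comp_symm_deriv hp
  have h' := hd.symm_comp_deriv (φ.map_target hp)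
  rw [φ.right_inv hp] at h'
  rw [mpullback_apply, ContinuousLinearMap.inverse_eq h' h]
  rfl

variable [IsManifold 𝓘(ℝ, XYSpace n) ∞ M]

theorem IsSmooth.contDiffAt_chartField {X : Field n M} (hX : IsSmooth X)
    (hφ : φ ∈ IsManifold.maximalAtlas 𝓘(ℝ, XYSpace n) ∞ M) {p : XYSpace n}
    (hp : p ∈ φ.target) : ContDiffAt ℝ ∞ (chartField φ X) p := by
  have h : ContMDiffAt 𝓘(ℝ, XYSpace n) 𝓘(ℝ, XYSpace n).tangent ∞ (fun q ↦
      (⟨q, mpullback 𝓘(ℝ, XYSpace n) 𝓘(ℝ, XYSpace n) φ.symm X q⟩ :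
        TangentBundle 𝓘(ℝ, XYSpace n) (XYSpace n))) p :=
    ContMDiffAt.mpullback_vectorField_preimage (n := ∞) (hX _)
      (contMDiffAt_symm_of_mem_maximalAtlas hφ hp) (isInvertible_mfderiv_chart_symm hφ hp)
      (by simp)
  refine (contMDiffAt_vectorSpace_iff_contDiffAt.1 h).congr_of_eventuallyEq ?_
  filter_upwards [φ.open_target.mem_nhds hp] with q hq
  exact (mpullback_chart_symm hφ X hq).symm

theorem isSmooth_of_contDiffAt_chartField {X : Field n M}
    (h : ∀ z, ∃ φ ∈ IsManifold.maximalAtlas 𝓘(ℝ, XYSpace n) ∞ M, z ∈ φ.source ∧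
      ContDiffAt ℝ ∞ (chartField φ X) (φ z)) : IsSmooth X := by
  intro z
  obtain ⟨φ, hφ, hz, hX⟩ := h z
  have h : ContMDiffAt 𝓘(ℝ, XYSpace n) 𝓘(ℝ, XYSpace n).tangent ∞ (fun w ↦
      (⟨w, mpullback 𝓘(ℝ, XYSpace n) 𝓘(ℝ, XYSpace n) φ (chartField φ X) w⟩ :
        TangentBundle 𝓘(ℝ, XYSpace n) M)) z :=
    ContMDiffAt.mpullback_vectorField_preimage (n := ∞)
      (contMDiffAt_vectorSpace_iff_contDiffAt.2 hX)
      (contMDiffAt_of_mem_maximalAtlas hφ hz) (isInvertible_mfderiv_chart hφ hz) (by simp)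
  refine h.congr_of_eventuallyEq ?_
  filter_upwards [φ.open_source.mem_nhds hz] with w hw
  congr 1
  change X w = (mfderiv 𝓘(ℝ, XYSpace n) 𝓘(ℝ, XYSpace n) φ w).inverse (chartField φ X (φ w))
  rw [chartField_apply X hw, components]
  obtain ⟨e, he⟩ := isInvertible_mfderiv_chart hφ hw
  rw [← he, ContinuousLinearMap.inverse_equiv]
  exact (e.symm_apply_apply _).symm

theorem mlieBracket_eq_lieBracket {E : Type*} [NormedAddCommGroup E] [NormedSpace ℝ E]
    (V W : E → E) : mlieBracket 𝓘(ℝ, E) V W = lieBracket ℝ V W := by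
  have h := mlieBracketWithin_eq_lieBracketWithin (𝕜 := ℝ) (V := V) (W := W) (s := Set.univ)
  exact mlieBracketWithin_univ.symm.trans (h.trans lieBracketWithin_univ)

theorem isManifold_minSmoothness : IsManifold 𝓘(ℝ, XYSpace n) (minSmoothness ℝ 2) M :=
  IsManifold.of_le (n := ∞) (by simpa using two_le_smoothness)

theorem components_bracket {X Y : Field n M} (hX : IsSmooth X) (hY : IsSmooth Y)
    (hφ : φ ∈ IsManifold.maximalAtlas 𝓘(ℝ, XYSpace n) ∞ M) {z : M} (hz : z ∈ φ.source) :
    components φ z (bracket X Y z) =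
      lieBracket ℝ (chartField φ X) (chartField φ Y) (φ z) := by
  have : IsManifold 𝓘(ℝ, XYSpace n) (minSmoothness ℝ 2) M := isManifold_minSmoothness
  have hp := φ.map_source hz
  rw [← chartField_apply _ hz, ← mpullback_chart_symm hφ _ hp,
    mpullback_mlieBracket (n := ∞) ((hX _).mdifferentiableAt (by simp))
      ((hY _).mdifferentiableAt (by simp)) (contMDiffAt_symm_of_mem_maximalAtlas hφ hp)
      (by simpa using two_le_smoothness)]
  refine (Filter.EventuallyEq.mlieBracket_vectorField_eq (V := chartField φ X)
    (W := chartField φ Y) ?_ ?_).trans (congrFun (mlieBracket_eq_lieBracket _ _) _) <;>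
  · filter_upwards [φ.open_target.mem_nhds hp] with q hq
    exact mpullback_chart_symm hφ _ hq

end Charts

/-! ### The vertical foliation in adapted coordinates -/

section Vertical

variable {n : ℕ} {M : Type*} [TopologicalSpace M] [ChartedSpace (XYSpace n) M]
  (τ : TangentStructure n M)

theorem app_mem_vert (X : Field n M) (x : M) : τ.app X x ∈ τ.vert x :=
  LinearMap.mem_range_self _ _

variable {φ : OpenPartialHomeomorph M (XYSpace n)}

/-- Since `im S = ker S` and `S` sends `(a, b)` to `(0, a)`, being vertical means `a = 0`. -/
theorem mem_vert_iff (hφ : IsAdaptedChart τ.S φ) {z : M} (hz : z ∈ φ.source) (v : T n M z) :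
    v ∈ τ.vert z ↔ (components φ z v).1 = 0 := by
  have hinj : Function.Injective (mfderiv 𝓘(ℝ, XYSpace n) 𝓘(ℝ, XYSpace n) φ z) :=
    (mdifferentiable_of_mem_maximalAtlas hφ.1).mfderiv_injective hz
  have h := hφ.2 z hz v
  rw [TangentStructure.vert, τ.range_eq_ker, LinearMap.mem_ker]
  change τ.S z v = 0 ↔ _
  constructor
  · intro h0
    rw [h0] at h
    have h1 : components φ z (0 : T n M z) = 0 := map_zero _
    rw [h1] at h
    exact (congrArg Prod.snd h).symm
  · intro h0
    rw [h0] at h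
    exact hinj (h.trans (map_zero (mfderiv 𝓘(ℝ, XYSpace n) 𝓘(ℝ, XYSpace n) φ z)).symm)

variable [IsManifold 𝓘(ℝ, XYSpace n) ∞ M]

/-- Smoothness of `S` comes from integrability: in an adapted chart `S` has constant coefficients.
-/
theorem isSmooth_app {X : Field n M} (hX : IsSmooth X) : IsSmooth (τ.app X) := by
  refine isSmooth_of_contDiffAt_chartField fun z ↦ ?_
  obtain ⟨φ, hz, hφ⟩ := τ.integrable z
  refine ⟨φ, hφ.1, hz, ?_⟩
  have hp := φ.map_source hz
  refine (contDiffAt_const (c := (0 : EuclideanSpace ℝ (Fin n))).prodMk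
    (hX.contDiffAt_chartField hφ.1 hp).fst).congr_of_eventuallyEq ?_
  filter_upwards [φ.open_target.mem_nhds hp] with q hq
  exact hφ.2 _ (φ.map_target hq) _

/-- The bracket of a vertical vector field with a foliated one is vertical. -/
theorem bracket_mem_vert_of_foliated (hφ : IsAdaptedChart τ.S φ) {V X : Field n M}
    (hV : IsSmooth V) (hVv : ∀ x, V x ∈ τ.vert x) (hX : IsSmooth X)
    {ξ : EuclideanSpace ℝ (Fin n) → EuclideanSpace ℝ (Fin n)}
    (hξ : ∀ w ∈ φ.source, (components φ w (X w)).1 = ξ (φ w).1) {z : M} (hz : z ∈ φ.source) :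
    bracket V X z ∈ τ.vert z := by
  have hp := φ.map_source hz
  rw [mem_vert_iff τ hφ hz, components_bracket hV hX hφ.1 hz, lieBracket]
  have hVd := (hV.contDiffAt_chartField hφ.1 hp).differentiableAt (by simp)
  have hXd := (hX.contDiffAt_chartField hφ.1 hp).differentiableAt (by simp)
  have hV0 : (fun q ↦ (chartField φ V q).1) =ᶠ[𝓝 (φ z)] fun _ ↦ 0 := by
    filter_upwards [φ.open_target.mem_nhds hp] with q hq
    exact (mem_vert_iff τ hφ (φ.map_target hq) _).1 (hVv _)
  have hX0 : (fun q ↦ (chartField φ X q).1) =ᶠ[𝓝 (φ z)] fun q ↦ ξ q.1 := by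
    filter_upwards [φ.open_target.mem_nhds hp] with q hq
    have h := hξ _ (φ.map_target hq)
    rwa [φ.right_inv hq] at h
  have h1 : (fderiv ℝ (chartField φ V) (φ z) (chartField φ X (φ z))).1 = 0 := by
    have h := congrArg (fun L ↦ L (chartField φ X (φ z))) (fderiv.fst hVd)
    rw [hV0.fderiv_eq] at h
    simpa using h.symm
  have h2 : (fderiv ℝ (chartField φ X) (φ z) (chartField φ V (φ z))).1 = 0 := by
    have hb : (chartField φ V (φ z)).1 = 0 := hV0.self_of_nhds
    -- `ξ` is not known to be differentiable, so no chain rule is used: along a line in the vertical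
    -- direction `x` is fixed, hence `ξ(x)` is constant and the directional derivative is zero.
    have hl := hXd.fst.hasFDerivAt.hasLineDerivAt (chartField φ V (φ z))
    change (ContinuousLinearMap.fst ℝ _ _ ∘L fderiv ℝ (chartField φ X) (φ z)) _ = 0
    rw [← fderiv.fst hXd]
    refine hl.unique (HasDerivAt.congr_of_eventuallyEq
      (hasDerivAt_const (0 : ℝ) (ξ (φ z).1)) ?_)
    have hc : Filter.Tendsto (fun t : ℝ ↦ φ z + t • chartField φ V (φ z)) (𝓝 0) (𝓝 (φ z)) := by
      have : Continuous fun t : ℝ ↦ φ z + t • chartField φ V (φ z) := by fun_prop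
      simpa using this.tendsto 0
    filter_upwards [hc.eventually hX0] with t ht
    rw [ht]
    simp [hb]
  rw [Prod.fst_sub, h1, h2, sub_zero]

theorem bracket_mem_vert {V W : Field n M} (hV : IsSmooth V) (hVv : ∀ x, V x ∈ τ.vert x)
    (hW : IsSmooth W) (hWv : ∀ x, W x ∈ τ.vert x) (z : M) : bracket V W z ∈ τ.vert z := by
  obtain ⟨φ, hz, hφ⟩ := τ.integrable z
  -- A vertical field is foliated with zero projection.
  exact bracket_mem_vert_of_foliated τ hφ hV hVv hW (ξ := fun _ ↦ 0)
    (fun w hw ↦ (mem_vert_iff τ hφ hw _).1 (hWv w)) hz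

end Vertical

/-! ### Pointwise algebra of the Lie bracket -/

section Bracket

variable {n : ℕ} {M : Type*} [TopologicalSpace M] [ChartedSpace (XYSpace n) M]
  {X Y Z : Field n M}

theorem bracket_swap_apply (X Y : Field n M) (x : M) : bracket X Y x = -bracket Y X x :=
  mlieBracket_swap_apply

theorem bracket_zero_apply (X : Field n M) (x : M) : bracket X 0 x = 0 :=
  congrFun mlieBracket_zero_right x

theorem zero_bracket_apply (X : Field n M) (x : M) : bracket 0 X x = 0 :=
  congrFun mlieBracket_zero_left x

variable [IsManifold 𝓘(ℝ, XYSpace n) ∞ M]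

theorem IsSmooth.mdifferentiableAt (hX : IsSmooth X) (x : M) :
    MDifferentiableAt 𝓘(ℝ, XYSpace n) 𝓘(ℝ, XYSpace n).tangent
      (fun x ↦ (⟨x, X x⟩ : TangentBundle 𝓘(ℝ, XYSpace n) M)) x :=
  (hX x).mdifferentiableAt (by simp)

theorem IsSmooth.bracket (hX : IsSmooth X) (hY : IsSmooth Y) : IsSmooth (bracket X Y) := by
  have : IsManifold 𝓘(ℝ, XYSpace n) ((((⊤ : ℕ∞) : ℕ∞ω)) + 1) M :=
    IsManifold.of_le (n := ∞) (by simp)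
  have : IsManifold 𝓘(ℝ, XYSpace n) (minSmoothness ℝ 2) M := isManifold_minSmoothness
  exact ContDiff.mlieBracket_vectorField (n := ⊤) (m := ⊤) hX hY (by simp)

theorem bracket_add_apply (hY : IsSmooth Y) (hZ : IsSmooth Z) (x : M) :
    bracket X (Y + Z) x = bracket X Y x + bracket X Z x := by
  have : IsManifold 𝓘(ℝ, XYSpace n) (minSmoothness ℝ 2) M := isManifold_minSmoothness
  exact mlieBracket_add_right (hY.mdifferentiableAt x) (hZ.mdifferentiableAt x)

theorem add_bracket_apply (hX : IsSmooth X) (hY : IsSmooth Y) (x : M) :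
    bracket (X + Y) Z x = bracket X Z x + bracket Y Z x := by
  have : IsManifold 𝓘(ℝ, XYSpace n) (minSmoothness ℝ 2) M := isManifold_minSmoothness
  exact mlieBracket_add_left (hX.mdifferentiableAt x) (hY.mdifferentiableAt x)

theorem bracket_neg_apply (hY : IsSmooth Y) (x : M) : bracket X (-Y) x = -bracket X Y x := by
  have : IsManifold 𝓘(ℝ, XYSpace n) (minSmoothness ℝ 2) M := isManifold_minSmoothness
  have h := mlieBracket_const_smul_right (V := X) (c := (-1 : ℝ)) (hY.mdifferentiableAt x)
  rwa [neg_one_smul, neg_one_smul] at h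

theorem bracket_jacobi_apply (hX : IsSmooth X) (hY : IsSmooth Y) (hZ : IsSmooth Z) (x : M) :
    bracket X (bracket Y Z) x = bracket (bracket X Y) Z x + bracket Y (bracket X Z) x := by
  have h : (minSmoothness ℝ 2 : ℕ∞ω) ≤ ∞ := by simpa using two_le_smoothness
  have : IsManifold 𝓘(ℝ, XYSpace n) (minSmoothness ℝ 3) M := IsManifold.of_le (n := ∞) (by
    have h : ((3 : ℕ∞) : ℕ∞ω) ≤ ∞ := WithTop.coe_le_coe.2 le_top
    simpa using h)
  exact leibniz_identity_mlieBracket_apply ((hX x).of_le h) ((hY x).of_le h) ((hZ x).of_le h)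

end Bracket

/-! ### Horizontal and vertical components -/

section Projections

variable {n : ℕ} {M : Type*} [TopologicalSpace M] [ChartedSpace (XYSpace n) M]
  [IsManifold 𝓘(ℝ, XYSpace n) ∞ M] {τ : TangentStructure n M} (ν : Normalization τ)
  {X Y Z V W : Field n M}

/-- `V` is a smooth vertical vector field. -/
def IsVertical (τ : TangentStructure n M) (V : Field n M) : Prop :=
  IsSmooth V ∧ ∀ x, V x ∈ τ.vert x

theorem isVertical_app (hX : IsSmooth X) : IsVertical τ (τ.app X) :=
  ⟨isSmooth_app τ hX, app_mem_vert τ X⟩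

theorem IsVertical.bracket (hV : IsVertical τ V) (hW : IsVertical τ W) :
    IsVertical τ (bracket V W) :=
  ⟨hV.1.bracket hW.1, bracket_mem_vert τ hV.1 hV.2 hW.1 hW.2⟩

namespace Normalization

theorem normal_add_tangential (X : Field n M) : ν.normal X + ν.tangential X = X :=
  funext fun x ↦ Submodule.projection_add_projection_eq_self (ν.isCompl x) (X x)

theorem pN_eq_zero {x : M} {v : T n M x} (hv : v ∈ τ.vert x) : ν.pN x v = 0 :=
  Submodule.projection_apply_of_mem_right (ν.isCompl x) hv

theorem pN_eq_self {x : M} {v : T n M x} (hv : v ∈ ν.N x) : ν.pN x v = v :=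
  Submodule.projection_apply_of_mem_left (ν.isCompl x) hv

theorem pT_eq_zero {x : M} {v : T n M x} (hv : v ∈ ν.N x) : ν.pT x v = 0 :=
  Submodule.projection_apply_of_mem_right (ν.isCompl x).symm hv

theorem pT_eq_self {x : M} {v : T n M x} (hv : v ∈ τ.vert x) : ν.pT x v = v :=
  Submodule.projection_apply_of_mem_left (ν.isCompl x).symm hv

theorem isHorizontal_normal (hX : IsSmooth X) : ν.IsHorizontal (ν.normal X) :=
  ⟨ν.smooth X hX, fun x ↦ Submodule.projection_apply_mem (ν.isCompl x) (X x)⟩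

theorem isVertical_tangential (hX : IsSmooth X) : IsVertical τ (ν.tangential X) := by
  refine ⟨?_, fun x ↦ Submodule.projection_apply_mem (ν.isCompl x).symm (X x)⟩
  have h : ν.tangential X = X - ν.normal X :=
    eq_sub_of_add_eq' (ν.normal_add_tangential X)
  rw [h]
  exact ContMDiff.sub_section hX (ν.smooth X hX)

variable {ν}

theorem IsHorizontal.normal_eq (hX : ν.IsHorizontal X) : ν.normal X = X :=
  funext fun x ↦ ν.pN_eq_self (hX.2 x)

theorem IsHorizontal.tangential_eq (hX : ν.IsHorizontal X) : ν.tangential X = 0 :=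
  funext fun x ↦ ν.pT_eq_zero (hX.2 x)

end Normalization

variable {ν}

theorem IsVertical.normal_eq (hV : IsVertical τ V) : ν.normal V = 0 :=
  funext fun x ↦ ν.pN_eq_zero (hV.2 x)

theorem IsVertical.tangential_eq (hV : IsVertical τ V) : ν.tangential V = V :=
  funext fun x ↦ ν.pT_eq_self (hV.2 x)

/-- The bracket with `X` splits along the decomposition `Y = p_N Y + p_T Y`. -/
theorem bracket_split_right (ν : Normalization τ) (X : Field n M) (hY : IsSmooth Y) (x : M) :
    bracket X Y x = bracket X (ν.normal Y) x + bracket X (ν.tangential Y) x := by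
  conv_lhs => rw [← ν.normal_add_tangential Y]
  exact bracket_add_apply (ν.isHorizontal_normal hY).1 (ν.isVertical_tangential hY).1 x

theorem bracket_split_left (ν : Normalization τ) (hX : IsSmooth X) (Y : Field n M) (x : M) :
    bracket X Y x = bracket (ν.normal X) Y x + bracket (ν.tangential X) Y x := by
  conv_lhs => rw [← ν.normal_add_tangential X]
  exact add_bracket_apply (ν.isHorizontal_normal hX).1 (ν.isVertical_tangential hX).1 x

/-- The discarded part `[V, p_T X]` is vertical by involutivity. -/
theorem pN_bracket_normal (hV : IsVertical τ V) (hX : IsSmooth X) (x : M) :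
    ν.pN x (bracket V (ν.normal X) x) = ν.pN x (bracket V X x) := by
  rw [bracket_split_right ν V hX, map_add,
    ν.pN_eq_zero ((hV.bracket (ν.isVertical_tangential hX)).2 x), add_zero]

end Projections

/-! ### The canonical connection and its curvature -/

section CanonicalConnection

variable {n : ℕ} {M : Type*} [TopologicalSpace M] [ChartedSpace (XYSpace n) M]
  [IsManifold 𝓘(ℝ, XYSpace n) ∞ M] {τ : TangentStructure n M} {ν : Normalization τ}
  {nabla : CovariantDerivative 𝓘(ℝ, XYSpace n) (XYSpace n) (T n M)}
  {γ : (x : M) → T n M x → T n M x → ℝ} {X Y Z V W : Field n M}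

theorem nabla_zero_apply (x : M) (v : T n M x) : nabla (0 : Field n M) x v = 0 := by
  rw [nabla.zero]
  rfl

/-- The direction `A` stays arbitrary because the curvature contains `D_{[X, Y]}`, and `[X, Y]` may
have both components. -/
theorem canonicalD_horizontal (A : Field n M) (hZ : ν.IsHorizontal Z) (x : M) :
    canonicalD ν nabla A Z x =
      ν.pN x (nabla Z x (ν.normal A x)) + ν.pN x (bracket (ν.tangential A) Z x) := by
  simp only [canonicalD, hZ.normal_eq, hZ.tangential_eq, nabla_zero_apply, bracket_zero_apply,
    map_zero, add_zero]

theorem canonicalD_vertical (A : Field n M) (hW : IsVertical τ W) (x : M) :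
    canonicalD ν nabla A W x =
      ν.pT x (nabla W x (ν.tangential A x)) + ν.pT x (bracket (ν.normal A) W x) := by
  simp only [canonicalD, hW.normal_eq, hW.tangential_eq, nabla_zero_apply, bracket_zero_apply,
    map_zero, add_zero, zero_add]

theorem canonicalD_horizontal_horizontal (hY : ν.IsHorizontal Y) (hZ : ν.IsHorizontal Z) :
    canonicalD ν nabla Y Z = ν.normal fun x ↦ nabla Z x (Y x) := by
  funext x
  rw [canonicalD_horizontal Y hZ, hY.normal_eq, hY.tangential_eq, zero_bracket_apply, map_zero,
    add_zero]
  rfl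

theorem canonicalD_vertical_horizontal (hV : IsVertical τ V) (hZ : ν.IsHorizontal Z) :
    canonicalD ν nabla V Z = ν.normal (bracket V Z) := by
  funext x
  rw [canonicalD_horizontal V hZ, hV.normal_eq, hV.tangential_eq, Pi.zero_apply, map_zero,
    map_zero, zero_add]
  rfl

theorem canonicalD_horizontal_vertical (hY : ν.IsHorizontal Y) (hW : IsVertical τ W) :
    canonicalD ν nabla Y W = ν.tangential (bracket Y W) := by
  funext x
  rw [canonicalD_vertical Y hW, hY.normal_eq, hY.tangential_eq, Pi.zero_apply, map_zero,
    map_zero, zero_add]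
  rfl

theorem canonicalD_vertical_vertical (hV : IsVertical τ V) (hW : IsVertical τ W) :
    canonicalD ν nabla V W = ν.tangential fun x ↦ nabla W x (V x) := by
  funext x
  rw [canonicalD_vertical V hW, hV.normal_eq, hV.tangential_eq, zero_bracket_apply, map_zero,
    add_zero]
  rfl

/-- The canonical connection is flat along the leaves on horizontal vector fields. -/
theorem canonicalR_vertical_vertical (hV : IsVertical τ V) (hW : IsVertical τ W)
    (hZ : ν.IsHorizontal Z) : canonicalR ν nabla V W Z = 0 := by
  funext x
  have hVZ := hV.1.bracket hZ.1
  have hWZ := hW.1.bracket hZ.1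
  simp only [canonicalR, curvature, Pi.sub_apply, Pi.zero_apply]
  rw [canonicalD_vertical_horizontal hW hZ, canonicalD_vertical_horizontal hV hZ,
    canonicalD_vertical_horizontal hV (ν.isHorizontal_normal hWZ),
    canonicalD_vertical_horizontal hW (ν.isHorizontal_normal hVZ),
    canonicalD_vertical_horizontal (hV.bracket hW) hZ]
  have h1 := pN_bracket_normal (ν := ν) hV hWZ x
  have h2 := pN_bracket_normal (ν := ν) hW hVZ x
  change ν.pN x _ - ν.pN x _ - ν.pN x _ = 0
  rw [h1, h2, bracket_jacobi_apply hV.1 hW.1 hZ.1, map_add]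
  abel

/-- The last two terms are `D_{[V, Y]} Z`, split along the components of `[V, Y]`. Both (2) and (4)
start from this expansion. -/
theorem canonicalR_vertical_horizontal (hnabla : IsLeviCivita γ nabla) (hV : IsVertical τ V)
    (hY : ν.IsHorizontal Y) (hZ : ν.IsHorizontal Z) (x : M) :
    canonicalR ν nabla V Y Z x =
      ν.pN x (bracket V (fun x ↦ nabla Z x (Y x)) x) -
      ν.pN x (nabla (ν.normal (bracket V Z)) x (Y x)) -
      ν.pN x (nabla Z x (ν.normal (bracket V Y) x)) -
      ν.pN x (bracket (ν.tangential (bracket V Y)) Z x) := by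
  have hYZ := hnabla.smooth Y Z hY.1 hZ.1
  simp only [canonicalR, curvature, Pi.sub_apply]
  rw [canonicalD_horizontal_horizontal hY hZ, canonicalD_vertical_horizontal hV hZ,
    canonicalD_vertical_horizontal hV (ν.isHorizontal_normal hYZ),
    canonicalD_horizontal_horizontal hY (ν.isHorizontal_normal (hV.1.bracket hZ.1)),
    canonicalD_horizontal _ hZ, ← sub_sub]
  have h1 := pN_bracket_normal (ν := ν) hV hYZ x
  rw [← h1]
  rfl

/-- An instance of the algebraic Bianchi identity for the canonical connection. -/
theorem canonicalR_vertical_horizontal_symm (hnabla : IsLeviCivita γ nabla)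
    (hV : IsVertical τ V) (hY : ν.IsHorizontal Y) (hZ : ν.IsHorizontal Z) :
    canonicalR ν nabla V Y Z = canonicalR ν nabla V Z Y := by
  funext x
  have hVY := hV.1.bracket hY.1
  have hVZ := hV.1.bracket hZ.1
  have hZY := hnabla.smooth Z Y hZ.1 hY.1
  rw [canonicalR_vertical_horizontal hnabla hV hY hZ,
    canonicalR_vertical_horizontal hnabla hV hZ hY]
  -- Here torsion-freeness is needed as an identity of fields, since the bracket with `V`
  -- differentiates it; in `e2` and `e3` its value at `x` suffices.
  have e1 : bracket V (fun x ↦ nabla Z x (Y x)) x =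
      bracket V (fun x ↦ nabla Y x (Z x)) x + bracket V (bracket Y Z) x := by
    rw [← bracket_add_apply hZY (hY.1.bracket hZ.1)]
    congr 1
    funext w
    exact (sub_eq_iff_eq_add'.1 (hnabla.torsion_free Y Z hY.1 hZ.1 w))
  have e2 := hnabla.torsion_free Y _ hY.1 (ν.isHorizontal_normal hVZ).1 x
  have e3 := hnabla.torsion_free Z _ hZ.1 (ν.isHorizontal_normal hVY).1 x
  have e4 := bracket_split_right ν Y hVZ x
  have e5 := bracket_split_right ν Z hVY x
  have e6 := bracket_jacobi_apply hV.1 hY.1 hZ.1 x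
  rw [bracket_swap_apply (ν.tangential (bracket V Y)),
    bracket_swap_apply (ν.tangential (bracket V Z)), e1, e6,
    bracket_swap_apply (bracket V Y) Z, e4, e5, ← e2, ← e3]
  simp only [map_add, map_sub, map_neg]
  abel

/-- With `T = p_T[X, Y]`, torsion-freeness trades `∇_W T` for `∇_T W + [W, T]`. The covariant
derivatives cancel, and the remaining brackets reassemble into the `p_T` part of Jacobi for `X, Y,
W`. -/
theorem canonicalR_horizontal_vertical (hnabla : IsLeviCivita γ nabla) (hW : IsVertical τ W)
    (hX : ν.IsHorizontal X) (hY : ν.IsHorizontal Y) :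
    canonicalR ν nabla X Y W = -covDerivTensor (canonicalD ν nabla) ν.theta W X Y := by
  funext x
  have hXY := hX.1.bracket hY.1
  have hXW := hX.1.bracket hW.1
  have hYW := hY.1.bracket hW.1
  have hWX := hW.1.bracket hX.1
  have hWY := hW.1.bracket hY.1
  simp only [canonicalR, curvature, covDerivTensor, Normalization.theta, Pi.sub_apply,
    Pi.neg_apply]
  rw [canonicalD_vertical_horizontal hW hX, canonicalD_vertical_horizontal hW hY,
    hX.normal_eq, hY.normal_eq, (ν.isHorizontal_normal hWX).normal_eq,
    (ν.isHorizontal_normal hWY).normal_eq,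
    canonicalD_horizontal_vertical hX hW, canonicalD_horizontal_vertical hY hW,
    canonicalD_horizontal_vertical hX (ν.isVertical_tangential hYW),
    canonicalD_horizontal_vertical hY (ν.isVertical_tangential hXW),
    canonicalD_vertical_vertical hW (ν.isVertical_tangential hXY),
    canonicalD_vertical _ hW]
  have e1 := hnabla.torsion_free W _ hW.1 (ν.isVertical_tangential hXY).1 x
  have e2 := bracket_split_right ν X hYW x
  have e3 := bracket_split_right ν Y hXW x
  have e4 := bracket_split_left ν hXY W x
  have e5 := bracket_jacobi_apply hX.1 hY.1 hW.1 x
  have swap (A : Field n M) : ν.normal (bracket W A) = -ν.normal (bracket A W) := by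
    funext w
    change ν.pN w _ = -ν.pN w _
    rw [bracket_swap_apply, map_neg]
  rw [swap X, swap Y]
  have e7 := bracket_swap_apply (-ν.normal (bracket X W)) Y x
  rw [bracket_neg_apply (ν.isHorizontal_normal hXW).1] at e7
  have e6 := bracket_neg_apply (X := X) (ν.isHorizontal_normal hYW).1 x
  change ν.pT x (bracket X (ν.tangential (bracket Y W)) x) -
      ν.pT x (bracket Y (ν.tangential (bracket X W)) x) -
      (ν.pT x (nabla W x (ν.tangential (bracket X Y) x)) +
        ν.pT x (bracket (ν.normal (bracket X Y)) W x)) =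
    -(ν.pT x (nabla (ν.tangential (bracket X Y)) x (W x)) -
      ν.pT x (bracket (-ν.normal (bracket X W)) Y x) -
      ν.pT x (bracket X (-ν.normal (bracket Y W)) x))
  rw [sub_eq_iff_eq_add.1 e1, bracket_swap_apply W, e6, e7, eq_sub_of_add_eq' e2.symm,
    eq_sub_of_add_eq' e3.symm, eq_sub_of_add_eq e4.symm, e5]
  simp only [map_add, map_sub, map_neg]
  abel

/-! ### Locality and foliated arguments -/

theorem nabla_eq_zero_of_eventuallyEq {A : Field n M} (hA : IsSmooth A) {x : M}
    (h : A =ᶠ[𝓝 x] 0) (v : T n M x) : nabla A x v = 0 := by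
  have h0 : IsSmooth (0 : Field n M) := by
    rw [← sub_self A]
    exact ContMDiff.sub_section hA hA
  have := nabla.isCovariantDerivativeOn.congr_of_eventuallyEq (hA.mdifferentiableAt x)
    (h0.mdifferentiableAt x) Filter.univ_mem h
  exact (congrArg (fun L ↦ L v) this).trans (nabla_zero_apply x v)

/-- The horizontal part of the bracket of a vertical field with a foliated one vanishes. -/
theorem normal_bracket_eq_zero {U : Set M} (hV : IsVertical τ V) (hX : IsSmooth X)
    (hXU : τ.IsFoliatedOn U X) {x : M} (hx : x ∈ U) : ν.normal (bracket V X) x = 0 := by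
  obtain ⟨φ, hz, -, hφ, ξ, hξ⟩ := hXU x hx
  exact ν.pN_eq_zero (bracket_mem_vert_of_foliated τ hφ hV.1 hV.2 hX hξ hz)

theorem canonicalR_vertical_foliated (hnabla : IsLeviCivita γ nabla) {U : Set M} (hU : IsOpen U)
    (hV : IsVertical τ V) (hY : ν.IsHorizontal Y) (hZ : ν.IsHorizontal Z)
    (hYU : τ.IsFoliatedOn U Y) (hZU : τ.IsFoliatedOn U Z) {x : M} (hx : x ∈ U) :
    canonicalR ν nabla V Y Z x = ν.normal (bracket V (canonicalD ν nabla Y Z)) x := by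
  have hYZ := hnabla.smooth Y Z hY.1 hZ.1
  -- This field gets differentiated by `nabla`, so it must vanish near `x`; openness of `U` provides
  -- this.
  have h0 : ν.normal (bracket V Z) =ᶠ[𝓝 x] 0 := by
    filter_upwards [hU.mem_nhds hx] with w hw
    exact normal_bracket_eq_zero hV hZ.1 hZU hw
  have h1 : ν.pN x (bracket (ν.tangential (bracket V Y)) Z x) = 0 :=
    normal_bracket_eq_zero (ν.isVertical_tangential (hV.1.bracket hY.1)) hZ.1 hZU hx
  rw [canonicalR_vertical_horizontal hnabla hV hY hZ,
    nabla_eq_zero_of_eventuallyEq (ν.isHorizontal_normal (hV.1.bracket hZ.1)).1 h0,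
    normal_bracket_eq_zero hV hY.1 hYU hx, h1, canonicalD_horizontal_horizontal hY hZ,
    map_zero, map_zero, map_zero, sub_zero, sub_zero, sub_zero]
  exact (pN_bracket_normal hV hYZ x).symm

theorem theta_eq_zero_left {A : Field n M} (B : Field n M) {x : M}
    (h : ν.normal A =ᶠ[𝓝 x] 0) : ν.theta A B x = 0 := by
  have h0 : bracket (ν.normal A) (ν.normal B) x = 0 :=
    (Filter.EventuallyEq.mlieBracket_vectorField_eq (I := 𝓘(ℝ, XYSpace n)) h
      (Filter.EventuallyEq.refl (𝓝 x) (ν.normal B))).trans (zero_bracket_apply _ x)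
  exact (congrArg (ν.pT x) h0).trans (map_zero _)

theorem theta_eq_zero_right (A : Field n M) {B : Field n M} {x : M}
    (h : ν.normal B =ᶠ[𝓝 x] 0) : ν.theta A B x = 0 := by
  have := theta_eq_zero_left A h
  change ν.pT x (bracket _ _ x) = 0 at this
  change ν.pT x (bracket _ _ x) = 0
  rw [bracket_swap_apply, map_neg, this, neg_zero]

/-- For foliated `A`, `D_W A = p_N[W, A]` vanishes near `x`, which kills both correction terms of
`D_W Θ`. -/
theorem canonicalR_foliated_vertical (hnabla : IsLeviCivita γ nabla) {U : Set M} (hU : IsOpen U)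
    (hW : IsVertical τ W) (hX : ν.IsHorizontal X) (hY : ν.IsHorizontal Y)
    (hXU : τ.IsFoliatedOn U X) (hYU : τ.IsFoliatedOn U Y) {x : M} (hx : x ∈ U) :
    canonicalR ν nabla X Y W x =
      -canonicalD ν nabla W (ν.tangential (bracket X Y)) x := by
  have h0 {A : Field n M} (hA : ν.IsHorizontal A) (hAU : τ.IsFoliatedOn U A) :
      ν.normal (canonicalD ν nabla W A) =ᶠ[𝓝 x] 0 := by
    rw [canonicalD_vertical_horizontal hW hA,
      (ν.isHorizontal_normal (hW.1.bracket hA.1)).normal_eq]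
    filter_upwards [hU.mem_nhds hx] with w hw
    exact normal_bracket_eq_zero hW hA.1 hAU hw
  rw [canonicalR_horizontal_vertical hnabla hW hX hY]
  simp only [covDerivTensor, Pi.neg_apply, Pi.sub_apply]
  rw [theta_eq_zero_left Y (h0 hX hXU), theta_eq_zero_right X (h0 hY hYU), sub_zero, sub_zero,
    Normalization.theta, hX.normal_eq, hY.normal_eq]

end CanonicalConnection

end TangentManifold

open TangentManifold in
theorem proposition3p3 {n : ℕ} {M : Type*} [TopologicalSpace M] [T2Space M]
    [SecondCountableTopology M] [ChartedSpace (XYSpace n) M]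
    [IsManifold 𝓘(ℝ, XYSpace n) ∞ M]
    (τ : TangentStructure n M) (ν : Normalization τ) (g : TransversalMetric τ)
    (nabla : CovariantDerivative 𝓘(ℝ, XYSpace n) (XYSpace n) (T n M))
    (hnabla : IsLeviCivita (ν.canonicalExtension g) nabla) :
    -- foliated horizontal arguments
    (∀ (U : Set M) (X Y Z : Field n M), IsOpen U →
      ν.IsHorizontal X → ν.IsHorizontal Y → ν.IsHorizontal Z →
      τ.IsFoliatedOn U X → τ.IsFoliatedOn U Y → τ.IsFoliatedOn U Z →
      ∀ x ∈ U,
        canonicalR ν nabla (τ.app X) (τ.app Y) Z x = 0 ∧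
        canonicalR ν nabla (τ.app X) Y Z x =
          ν.normal (bracket (τ.app X) (canonicalD ν nabla Y Z)) x ∧
        canonicalR ν nabla X Y (τ.app Z) x =
          - canonicalD ν nabla (τ.app Z) (ν.tangential (bracket X Y)) x ∧
        canonicalR ν nabla (τ.app X) Y Z x = canonicalR ν nabla (τ.app X) Z Y x) ∧
    -- arbitrary horizontal arguments
    (∀ X Y Z : Field n M, ν.IsHorizontal X → ν.IsHorizontal Y → ν.IsHorizontal Z →
      canonicalR ν nabla (τ.app X) (τ.app Y) Z = 0 ∧
      canonicalR ν nabla X Y (τ.app Z) =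
        - covDerivTensor (canonicalD ν nabla) ν.theta (τ.app Z) X Y ∧
      canonicalR ν nabla (τ.app X) Y Z = canonicalR ν nabla (τ.app X) Z Y) := by
  refine ⟨fun U X Y Z hU hX hY hZ hXU hYU hZU x hx ↦ ⟨?_, ?_, ?_, ?_⟩,
    fun X Y Z hX hY hZ ↦ ⟨?_, ?_, ?_⟩⟩
  · rw [canonicalR_vertical_vertical (isVertical_app hX.1) (isVertical_app hY.1) hZ]
    rfl
  · exact canonicalR_vertical_foliated hnabla hU (isVertical_app hX.1) hY hZ hYU hZU hx
  · exact canonicalR_foliated_vertical hnabla hU (isVertical_app hZ.1) hX hY hXU hYU hx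
  · rw [canonicalR_vertical_horizontal_symm hnabla (isVertical_app hX.1) hY hZ]
  · exact canonicalR_vertical_vertical (isVertical_app hX.1) (isVertical_app hY.1) hZ
  · exact canonicalR_horizontal_vertical hnabla (isVertical_app hZ.1) hX hY
  · exact canonicalR_vertical_horizontal_symm hnabla (isVertical_app hX.1) hY hZ
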